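/- **Setting.** Let $\mathbb K/\mathbb E$ and $\mathbb F/\mathbb E$ be finite field extensions inside a common field, with $[\mathbb F:\mathbb E]=m$, $\mathbb K\cap\mathbb F=\mathbb E$ and $\mathbb L:=\mathbb F\mathbb K$. Assume that $\mathbb L/\mathbb K$ is a cyclic Galois extension of degree $m$, and let $\sigma\in\mathrm{Gal}(\mathbb L/\mathbb K)$ restrict to an automorphism $\theta=\sigma|_{\mathbb F}$ of $\mathbb F$ of order $m$ with fixed field $\mathbb F^\theta=\mathbb E$. Let $\ell\ge 1$ be an integer with $\gcd(\ell,m)=1$. A linear code $\mathcal C_1\subseteq\mathbb F^\ell$ is *cyclic* if it is stable under $(c_0,\dots,c_{\ell-1})\mapsto(c_{\ell-1},c_0,\dots,c_{\ell-2})$. Its *generator polynomial* is the monic divisor $f_1$ of $x^\ell-1$ such that $\mathcal C_1$, identified with a subset of $\mathbb F[x]/(x^\ell-1)$ through $u\mapsto\sum_i u_ix^i$, is the ideal $(f_1)$, and $$T^{\mathrm H}_{\mathcal C_1}=\{\alpha\in\mathbb L \mid \alpha^\ell=1,\ f_1(\alpha)=0\}.$$ A linear code $\mathcal C_2\subseteq\mathbb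 F^m$ is *skew-cyclic* if it is stable under $(v_0,\dots,v_{m-1})\mapsto(\theta(v_{m-1}),\theta(v_0),\dots,\theta(v_{m-2}))$. Let $\mathbb F[z;\theta]$ be the skew polynomial ring with $zc=\theta(c)z$, and let $f_2\in\mathbb F[z;\theta]$ be a generator of $\mathcal C_2$, i.e. $\mathcal C_2$, identified with a subset of $\mathbb F[z;\theta]/(z^m-1)$ through $v\mapsto\sum_j v_jz^j$, is the left ideal $(f_2)$. Then $$T^{\mathrm R}_{\mathcal C_2}=\{\gamma\in\mathbb L^* \mid f_2(\sigma(\gamma)\gamma^{-1})=0\},$$ where for $f\in\mathbb L[z;\sigma]$ and $c\in\mathbb L$ the value $f(c)\in\mathbb L$ is defined by $f(z)=q(z)(z-c)+f(c)$ with $q\in\mathbb L[z;\sigma]$. For $A\subseteq X$, $B\subseteq Y$ put $A\uplus B=\{(x,y)\in X\times Y\mid x\in A\text{ or }y\in B\}$. The rank weight of $v\in\mathbb F^m$ is $\dim_{\mathbb E}\langle v_0,\dots,v_{m-1}\rangle_{\mathbb E}$. **Theorem 6.2 (Roos Product Bound).** Let $\mathcal C_1\subseteq\mathbb F^\ell$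 be a nonzero cyclic code with minimum Hamming distance $d_{\mathrm H}$ whose generator polynomial lies in $\mathbb E[x]$, and let $\mathcal C_2\subseteq\mathbb F^m$ be a nonzero skew-cyclic code with minimum rank distance $d_{\mathrm R}$. Let $r\ge 0$ and $b,s,\delta,k_0,\dots,k_r$ be integers such that $\gcd(\ell m,s)=1$, $k_j<k_{j+1}$ for $0\le j\le r-1$, and $k_r-k_0\le\delta+r-2$. Let $a\in\mathbb K$ be a primitive $\ell$-th root of unity and let $\beta\in\mathbb L^*$ be a normal element of $\mathbb L/\mathbb K$ (its conjugates under $\mathrm{Gal}(\mathbb L/\mathbb K)$ form a $\mathbb K$-basis of $\mathbb L$). If $$\{(a^{b+si+k_j},\ \sigma^{si+k_j}(\beta)) \mid 0\le i\le\delta-2,\ 0\le j\le r\}\subseteq T^{\mathrm H}_{\mathcal C_1}\uplus T^{\mathrm R}_{\mathcal C_2},$$ then $$d_{\mathrm H}\ge\left\lceil\frac{\delta+r}{d_{\mathrm R}}\right\rceil\qquad\text{and}\qquad d_{\mathrm R}\ge\left\lceil\frac{\delta+r}{d_{\mathrm H}}\right\rceil.$$ -/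

import Mathlib

noncomputable section

namespace RoosProduct

open Polynomial

section Metrics

/-- Minimum distance `min {d(u,v) | u, v ∈ C, u ≠ v}` of a set `C` with respect to `d`.
(Only meaningful when `C` has at least two elements.) -/
def minDist {V : Type*} (d : V → V → ℕ) (C : Set V) : ℕ :=
  sInf {w | ∃ u ∈ C, ∃ v ∈ C, u ≠ v ∧ w = d u v}

open Classical in
/-- The minimum Hamming distance of a linear code `C ⊆ F ^ ℓ`. -/
def minHammingDist {F : Type*} [Field F] {ℓ : ℕ} (C : Submodule F (Fin ℓ → F)) : ℕ :=
  minDist (fun u v : Fin ℓ → F => hammingDist u v) (C : Set (Fin ℓ → F))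

/-- The rank weight of `c ∈ F ^ N` for `F / E`: the `E`-dimension of the `E`-span of the entries. -/
def rankWeight (E : Type*) {F : Type*} [Field E] [Field F] [Algebra E F] {N : ℕ}
    (c : Fin N → F) : ℕ :=
  Module.finrank E (Submodule.span E (Set.range c))

/-- The minimum rank distance, for `F / E`, of a linear code `C ⊆ F ^ N`. -/
def minRankDist (E : Type*) {F : Type*} [Field E] [Field F] [Algebra E F] {N : ℕ}
    (C : Submodule F (Fin N → F)) : ℕ :=
  minDist (fun u v : Fin N → F => rankWeight E (u - v)) (C : Set (Fin N → F))

end Metrics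

section Cyclic

variable {F : Type*} [Field F] {ℓ : ℕ}

/-- `C` is cyclic: it is stable under `(c_0, …, c_{ℓ-1}) ↦ (c_{ℓ-1}, c_0, …, c_{ℓ-2})`. -/
def IsCyclicCode (C : Submodule F (Fin ℓ → F)) : Prop :=
  ∀ c ∈ C, (fun i => c ((finRotate ℓ).symm i)) ∈ C

/-- The ring `F[x] / (x ^ ℓ - 1)`. -/
abbrev CyclicRing (F : Type*) [Field F] (ℓ : ℕ) : Type _ :=
  F[X] ⧸ Ideal.span {(X ^ ℓ - 1 : F[X])}

/-- The identification `F ^ ℓ → F[x] / (x ^ ℓ - 1)`, `u ↦ ∑ u_i x ^ i`. -/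
def cyclicPoly (u : Fin ℓ → F) : CyclicRing F ℓ :=
  Ideal.Quotient.mk _ (∑ i : Fin ℓ, monomial (i : ℕ) (u i))

/-- `f` is the generator polynomial of the cyclic code `C`: the monic divisor of `x ^ ℓ - 1` such
that `C`, viewed in `F[x] / (x ^ ℓ - 1)`, is the ideal `(f)`. -/
def IsGeneratorPoly (C : Submodule F (Fin ℓ → F)) (f : F[X]) : Prop :=
  f.Monic ∧ f ∣ X ^ ℓ - 1 ∧
    cyclicPoly '' (C : Set (Fin ℓ → F)) =
      (Ideal.span {Ideal.Quotient.mk _ f} : Ideal (CyclicRing F ℓ))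

/-- The Hamming defining set in `L` of the cyclic code of length `ℓ` generated by `f`. -/
def hammingDefiningSet (L : Type*) [Field L] [Algebra F L] (ℓ : ℕ) (f : F[X]) : Set L :=
  {a | a ^ ℓ = 1 ∧ aeval a f = 0}

end Cyclic

section Skew

/-- The action of `ℕ` (written multiplicatively) on `R` by the iterates of `θ`. -/
abbrev iterateAction {R : Type*} [Ring R] (θ : R →+* R) :
    MulSemiringAction (Multiplicative ℕ) R :=
  MulSemiringAction.compHom R (powersHom (R →+* R) θ)

/-- The skew polynomial ring `R[z; θ]`, with `z a = θ(a) z`: Mathlib's `SkewPolynomial R` for the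
action of `ℕ` by iterates of `θ`. -/
def SkewPoly (R : Type*) [Ring R] (_θ : R →+* R) : Type _ := SkewPolynomial R

instance {R : Type*} [Ring R] (θ : R →+* R) : Ring (SkewPoly R θ) :=
  letI := iterateAction θ
  inferInstanceAs (Ring (SkewPolynomial R))

/-- The monomial `c z ^ n` of `R[z; θ]`. -/
def SkewPoly.monomial {R : Type*} [Ring R] (θ : R →+* R) (n : ℕ) (c : R) : SkewPoly R θ :=
  SkewPolynomial.monomial n c

/-- The element of `S[z; σ]` with the same coefficients as `f ∈ R[z; θ]`, for an
`R`-algebra `S`. -/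
def SkewPoly.baseChange {R S : Type*} [CommRing R] [CommRing S] [Algebra R S]
    {θ : R →+* R} (σ : S →+* S) (f : SkewPoly R θ) : SkewPoly S σ :=
  SkewPolynomial.sum (R := R) f (fun n c => SkewPoly.monomial σ n (algebraMap R S c))

/-- `f(a) = c` for the right evaluation of `f ∈ R[z; θ]` at `a`:
`f(z) = q(z) (z - a) + c` for some `q`. -/
def SkewPoly.HasEval {R : Type*} [Ring R] {θ : R →+* R} (f : SkewPoly R θ) (a c : R) : Prop :=
  ∃ q : SkewPoly R θ,
    f = q * (SkewPoly.monomial θ 1 1 - SkewPoly.monomial θ 0 a) + SkewPoly.monomial θ 0 c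

variable {F : Type*} [Field F] {N : ℕ}

/-- `C` is skew-cyclic with respect to `θ`: it is stable under
`(v_0, …, v_{N-1}) ↦ (θ(v_{N-1}), θ(v_0), …, θ(v_{N-2}))`. -/
def IsSkewCyclicCode (θ : F →+* F) (C : Submodule F (Fin N → F)) : Prop :=
  ∀ v ∈ C, (fun i => θ (v ((finRotate N).symm i))) ∈ C

/-- The congruence on `F[z; θ]` modulo the two-sided ideal generated by `z ^ N - 1`. -/
abbrev skewCyclicCon (θ : F →+* F) (N : ℕ) : RingCon (SkewPoly F θ) :=
  (TwoSidedIdeal.span {SkewPoly.monomial θ N 1 - 1}).ringCon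

/-- The ring `F[z; θ] / (z ^ N - 1)`. -/
abbrev SkewCyclicRing (θ : F →+* F) (N : ℕ) : Type _ := (skewCyclicCon θ N).Quotient

/-- The identification `F ^ N → F[z; θ] / (z ^ N - 1)`, `v ↦ ∑ v_j z ^ j`. -/
def skewCyclicPoly (θ : F →+* F) (v : Fin N → F) : SkewCyclicRing θ N :=
  (skewCyclicCon θ N).mk' (∑ j : Fin N, SkewPoly.monomial θ (j : ℕ) (v j))

/-- `f` generates the skew-cyclic code `C`: viewed in `F[z; θ] / (z ^ N - 1)`, `C` is the left
ideal `(f)`. (`Ideal` means left ideal.) -/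
def IsSkewGenerator (θ : F →+* F) (C : Submodule F (Fin N → F)) (f : SkewPoly F θ) : Prop :=
  skewCyclicPoly θ '' (C : Set (Fin N → F)) =
    (Ideal.span {(skewCyclicCon θ N).mk' f} : Ideal (SkewCyclicRing θ N))

/-- The rank defining set in `Lˣ` of the skew-cyclic code generated by `f`: those `β` with
`f(σ(β) β⁻¹) = 0`, evaluated in `L[z; σ]`. -/
def rankDefiningSet {L : Type*} [Field L] [Algebra F L] {θ : F →+* F} (σ : L →+* L)
    (f : SkewPoly F θ) : Set Lˣ :=
  {β | (f.baseChange σ).HasEval (σ β * (β : L)⁻¹) 0}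

end Skew

/-- `A ⊎ B = {(x, y) | x ∈ A or y ∈ B}`. -/
def uplus {X Y : Type*} (A : Set X) (B : Set Y) : Set (X × Y) :=
  {p | p.1 ∈ A ∨ p.2 ∈ B}

/-- `β` is a normal element of `L / K`: its Galois conjugates form a `K`-basis of `L`. -/
def IsNormalElement (K : Type*) {L : Type*} [Field K] [Field L] [Algebra K L] (β : L) : Prop :=
  LinearIndependent K (fun g : L ≃ₐ[K] L => g β) ∧
    Submodule.span K (Set.range fun g : L ≃ₐ[K] L => g β) = ⊤

/-- The set of pairs `(a ^ (b + s i + k_j), σ ^ (s i + k_j) (β))`, `0 ≤ i ≤ δ - 2`, `0 ≤ j ≤ r`. -/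
def roosSet {K L : Type*} [Field K] [Field L] [Algebra K L] (σ : L ≃ₐ[K] L) (a : K) (β : Lˣ)
    (b s δ : ℤ) {r : ℕ} (k : Fin (r + 1) → ℤ) : Set (L × Lˣ) :=
  {p | ∃ i : ℤ, 0 ≤ i ∧ i ≤ δ - 2 ∧ ∃ j : Fin (r + 1),
    p = (algebraMap K L (a ^ (b + s * i + k j)),
      Units.map ((σ ^ (s * i + k j) : L ≃ₐ[K] L) : L →* L) β)}

end RoosProduct

end

/-!
Both inequalities say that `δ + r ≤ d_H d_R`. Let `c` be a codeword of `C₁` of Hamming weight `d_H`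
and `v` a codeword of `C₂` of rank weight `d_R`. The hypothesis says that for each `n = s i + k_j`
one of `∑ u, c_u a ^ (u (b + n))` and `∑ j, v_j σ ^ j (σ ^ n (β))` vanishes: codewords vanish on the
defining sets (`sum_mul_pow_eq_zero`, and `sum_mul_iterate_eq_zero`, in which a skew polynomial
acts on `L` through `z ↦ σ`). Hence their product is `0`.

As `a` lies in `K`, the entries of `c` may be replaced by their images under a `K`-linear functional
`L → K` that is nonzero on one of them. A rank factorization `v_j = ∑ p, e_pj g_p` with `e_pj` in
`E` turns the second sum into `∑ p, g_p σ ^ n (w_p)`, where `w_p = ∑ j, e_pj σ ^ j (β)`. The `g_p`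
are `K`-linearly independent because `K` and `F` are linearly disjoint, the `w_p` because `β` is
normal. Applying `σ ^ (-k_j)` to the second sum, the vanishing of the product becomes, with columns
indexed by the pairs `(u, p)`, the orthogonality of the rows
`(a ^ (u s i) σ ^ (s i) (w_p))_{u, p}` and `(c_u a ^ (u (b + k_j)) σ ^ (-k_j) (g_p))_{u, p}`.

Both families consist of rows of generalized Moore matrices, for the automorphisms `σ ^ s` and
`σ⁻¹`, and consecutive rows of such a matrix have the largest possible rank
(`linearIndependent_moore`). This holds because a nonzero skew polynomial of degree less than `M`
cannot have zeros of total dimension `M` in classes `{a_u τ(x) / x}` with distinct norms `a_u ^ m`;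
here the norms are distinct because `ℓ` and `m` are coprime. As the `k_j` miss few integers between
`k_0` and `k_r`, orthogonality forces more columns than `δ + r - 1`
(`lt_card_of_orthogonal`), and there are at most `d_H d_R` columns.
-/

noncomputable section

namespace RoosProduct

open Polynomial

/-! ### Zeros of skew polynomials and generalized Moore matrices -/

section Moore

variable {K L : Type*} [Field K] [Field L] [Algebra K L]

/-- The `K`-linear operator `x ↦ a τ(x)` on `L`. -/
def scaledAut (τ : L ≃ₐ[K] L) (a : K) : L →ₗ[K] L := a • τ.toLinearMap

lemma scaledAut_apply (τ : L ≃ₐ[K] L) (a : K) (x : L) : scaledAut τ a x = a • τ x := rfl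

lemma scaledAut_pow_apply (τ : L ≃ₐ[K] L) (a : K) (n : ℕ) (x : L) :
    (scaledAut τ a ^ n) x = a ^ n • (τ ^ n) x := by
  induction n with
  | zero => simp
  | succ n ih =>
    rw [pow_succ', Module.End.mul_apply, ih, scaledAut_apply, map_smul, smul_smul, pow_succ' τ,
      AlgEquiv.mul_apply, pow_succ']

/-- Right division by `z - c` in the skew polynomial ring, seen through the operators
`z ↦ scaledAut τ a`: the quotient `q` and remainder `ρ` do not depend on `a`. -/
lemma exists_div_scaledAut (τ : L ≃ₐ[K] L) (c : L) (M : ℕ) (lam : ℕ → L) :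
    ∃ (q : ℕ → L) (ρ : L),
      (∀ (a : K) (x : L), ∑ n ∈ Finset.range (M + 1), lam n * (scaledAut τ a ^ n) x =
        ∑ n ∈ Finset.range M, q n * (scaledAut τ a ^ n) (scaledAut τ a x - c * x) + ρ * x) ∧
      ((∀ n < M, q n = 0) → ρ = 0 → ∀ n < M + 1, lam n = 0) := by
  induction M generalizing lam with
  | zero => exact ⟨0, lam 0, by simp, fun _ h n hn => by simpa [Nat.lt_one_iff.mp hn] using h⟩
  | succ M ih =>
    -- `λ z ^ (M + 1) = λ z ^ M (z - c) + λ τ ^ M (c) z ^ M`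
    obtain ⟨q, ρ, h1, h2⟩ :=
      ih (Function.update lam M (lam M + lam (M + 1) * (τ ^ M) c))
    refine ⟨Function.update q M (lam (M + 1)), ρ, fun a x => ?_, fun hq hρ n hn => ?_⟩
    · have h := h1 a x
      have e1 : ∀ n ∈ Finset.range M,
          Function.update lam M (lam M + lam (M + 1) * (τ ^ M) c) n * (scaledAut τ a ^ n) x =
            lam n * (scaledAut τ a ^ n) x := fun n hn => by
        rw [Function.update_of_ne (Finset.mem_range.mp hn).ne]
      have e2 : ∀ n ∈ Finset.range M,
          Function.update q M (lam (M + 1)) n *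
              (scaledAut τ a ^ n) (scaledAut τ a x - c * x) =
            q n * (scaledAut τ a ^ n) (scaledAut τ a x - c * x) := fun n hn => by
        rw [Function.update_of_ne (Finset.mem_range.mp hn).ne]
      rw [Finset.sum_range_succ, Finset.sum_congr rfl e1, Function.update_self] at h
      rw [Finset.sum_range_succ, Finset.sum_range_succ, Finset.sum_range_succ _ M,
        Finset.sum_congr rfl e2, Function.update_self]
      have e3 : (scaledAut τ a ^ M) (c * x) = (τ ^ M) c * (scaledAut τ a ^ M) x := by
        simp only [scaledAut_pow_apply, map_mul, mul_smul_comm]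
      have e4 : (scaledAut τ a ^ (M + 1)) x = (scaledAut τ a ^ M) (scaledAut τ a x) := by
        rw [pow_succ, Module.End.mul_apply]
      rw [map_sub, e3, e4]
      linear_combination h
    · have hM : lam (M + 1) = 0 := by simpa using hq M (Nat.lt_succ_self M)
      rcases Nat.lt_succ_iff_lt_or_eq.mp hn with hn' | rfl
      · have := h2 (fun n hn => by
          simpa [Function.update_of_ne hn.ne] using hq n (hn.trans (Nat.lt_succ_self M))) hρ n hn'
        by_cases h : n = M
        · subst h
          simpa [hM] using this
        · simpa [Function.update_of_ne h] using this
      · exact hM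

/-- The values `a τ(x) / x` and `a' τ(y) / y` can only agree if `a` and `a'` have the same `m`-th
power, where `τ ^ m = 1`: then `y / x` is fixed by the `m`-th power of `(a' / a) τ`, which is
multiplication by `(a' / a) ^ m`. -/
lemma pow_eq_of_scaledAut_eq {τ : L ≃ₐ[K] L} {m : ℕ} (hτ : τ ^ m = 1) {a a' : K} {x y : L}
    (hx : x ≠ 0) (hy : y ≠ 0) (ha : a ≠ 0)
    (h : scaledAut τ a' y * x = scaledAut τ a x * y) : a' ^ m = a ^ m := by
  have key : scaledAut τ (a' / a) (y / x) = y / x := by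
    have hx' : τ x ≠ 0 := by simpa using hx
    have ha' : algebraMap K L a ≠ 0 := by simpa using ha
    simp only [scaledAut_apply, Algebra.smul_def, map_div₀] at h ⊢
    field_simp
    linear_combination h
  have hit : ∀ n : ℕ, (scaledAut τ (a' / a) ^ n) (y / x) = y / x := fun n => by
    induction n with
    | zero => simp
    | succ n ih => rw [pow_succ, Module.End.mul_apply, key, ih]
  have h1 := hit m
  rw [scaledAut_pow_apply, hτ, AlgEquiv.one_apply, Algebra.smul_def, mul_eq_right₀
    (div_ne_zero hy hx), ← map_one (algebraMap K L)] at h1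
  have h2 := (algebraMap K L).injective h1
  rwa [div_pow, div_eq_one_iff_eq (pow_ne_zero _ ha)] at h2

/-- A skew polynomial of degree less than `M` which, for every `u`, is annihilated at a subspace
`W u` of the class of `a u`, is zero as soon as the dimensions of the `W u` add up to `M`. -/
theorem eq_zero_of_forall_scaledAut {U : Type*} [Fintype U] [FiniteDimensional K L]
    {τ : L ≃ₐ[K] L} {m : ℕ} (hτ : τ ^ m = 1)
    (hfix : ∀ x, τ x = x → x ∈ Set.range (algebraMap K L)) {a : U → K} (ha0 : ∀ u, a u ≠ 0)
    (ha : Function.Injective fun u => a u ^ m) (M : ℕ) (W : U → Submodule K L) (lam : ℕ → L)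
    (hW : M ≤ ∑ u, Module.finrank K (W u))
    (h : ∀ u, ∀ x ∈ W u, ∑ n ∈ Finset.range M, lam n * (scaledAut τ (a u) ^ n) x = 0) :
    ∀ n < M, lam n = 0 := by
  classical
  induction M generalizing W lam with
  | zero => simp
  | succ M ih =>
    obtain ⟨u₀, hu₀⟩ : ∃ u, W u ≠ ⊥ := by
      by_contra! hbot
      have h0 : ∀ u, Module.finrank K (W u) = 0 := fun u => by rw [hbot u, finrank_bot]
      simp [h0] at hW
    obtain ⟨g, hg, hg0⟩ := (W u₀).ne_bot_iff.mp hu₀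
    -- divide by `z - c`, where `c` is the zero belonging to `g`
    set c : L := scaledAut τ (a u₀) g / g with hc
    have hcg : scaledAut τ (a u₀) g - c * g = 0 := by
      rw [hc, div_mul_cancel₀ _ hg0, sub_self]
    obtain ⟨q, ρ, h1, h2⟩ := exists_div_scaledAut τ c M lam
    have hρ : ρ = 0 := by
      have := h u₀ g hg
      rw [h1, hcg] at this
      simpa [hg0] using this
    -- `D u` maps `W u` to zeros of the quotient; it kills the line `K g` for `u = u₀` and is
    -- injective for all other `u`, so that the total dimension drops by at most one
    let D : U → L →ₗ[K] L := fun u => scaledAut τ (a u) - LinearMap.mulLeft K c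
    have hker : ∀ u, Module.finrank K (LinearMap.ker (D u)) ≤ if u = u₀ then 1 else 0 := by
      intro u
      have hmem : ∀ x ∈ LinearMap.ker (D u),
          scaledAut τ (a u) x * g = scaledAut τ (a u₀) g * x := by
        intro x hx
        have hx' : scaledAut τ (a u) x - c * x = 0 := hx
        rw [sub_eq_zero.mp hx', hc]
        field_simp
      split_ifs with hu
      · subst hu
        refine (Submodule.finrank_mono (t := K ∙ g) fun x hx => ?_).trans 
          ((finrank_span_le_card {g}).trans (by simp))
        have hx' := hmem x hx
        obtain ⟨κ, hκ⟩ := hfix (x / g) (by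
          have hg' : τ g ≠ 0 := by simpa using hg0
          have ha' : algebraMap K L (a u) ≠ 0 := by simpa using ha0 u
          rw [scaledAut_apply, scaledAut_apply, Algebra.smul_def, Algebra.smul_def, mul_assoc,
            mul_assoc] at hx'
          have hx'' := mul_left_cancel₀ ha' hx'
          rw [map_div₀]
          field_simp
          linear_combination hx'')
        exact Submodule.mem_span_singleton.mpr ⟨κ, by
          rw [Algebra.smul_def, hκ, div_mul_cancel₀ _ hg0]⟩
      · have : LinearMap.ker (D u) = ⊥ := by
          rw [eq_bot_iff]
          intro x hx
          by_contra hx0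
          exact hu (ha (pow_eq_of_scaledAut_eq hτ hg0 hx0 (ha0 u₀) (hmem x hx)))
        simp [this]
    have hdim : ∀ u, Module.finrank K (W u) ≤
        Module.finrank K ((W u).map (D u)) + if u = u₀ then 1 else 0 := by
      intro u
      have e := LinearMap.finrank_range_add_finrank_ker ((D u).domRestrict (W u))
      rw [LinearMap.range_domRestrict] at e
      have : Module.finrank K (LinearMap.ker ((D u).domRestrict (W u))) ≤
          Module.finrank K (LinearMap.ker (D u)) := by
        rw [← Submodule.finrank_map_subtype_eq]
        refine Submodule.finrank_mono ?_
        rintro _ ⟨y, hy, rfl⟩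
        exact hy
      have := hker u
      omega
    refine h2 (ih (fun u => (W u).map (D u)) q ?_ ?_) hρ
    · have := Finset.sum_le_sum fun u (_ : u ∈ Finset.univ) => hdim u
      rw [Finset.sum_add_distrib] at this
      simp only [Finset.sum_ite_eq', Finset.mem_univ, if_true] at this
      omega
    · rintro u _ ⟨x, hx, rfl⟩
      have := h u x hx
      rw [h1, hρ, zero_mul, add_zero] at this
      exact this

/-- The `n`-th row `(d_u a_u ^ n τ ^ n (g_p))_{u, p}` of a generalized Moore matrix. -/
def mooreRow {U P : Type*} (τ : L ≃ₐ[K] L) (a : U → K) (d : U → L) (g : P → L) (n : ℕ)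
    (x : U × P) : L :=
  d x.1 * (a x.1 ^ n • (τ ^ n) (g x.2))

/-- The first `M` rows of a generalized Moore matrix with at least `M` columns are `L`-linearly
independent. -/
theorem linearIndependent_moore {U P : Type*} [Fintype U] [Fintype P] [FiniteDimensional K L]
    {τ : L ≃ₐ[K] L} {m : ℕ} (hτ : τ ^ m = 1)
    (hfix : ∀ x, τ x = x → x ∈ Set.range (algebraMap K L)) {a : U → K} (ha0 : ∀ u, a u ≠ 0)
    (ha : Function.Injective fun u => a u ^ m) {d : U → L} (hd : ∀ u, d u ≠ 0) {g : P → L}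
    (hg : LinearIndependent K g) {M : ℕ} (hM : M ≤ Fintype.card U * Fintype.card P) :
    LinearIndependent L fun n : Fin M => mooreRow τ a d g n := by
  rw [Fintype.linearIndependent_iff]
  intro lam hlam
  set lam' : ℕ → L := fun n => if hn : n < M then lam ⟨n, hn⟩ else 0 with hlam'
  suffices ∀ n < M, lam' n = 0 from fun n => by simpa [hlam'] using this n n.2
  refine eq_zero_of_forall_scaledAut hτ hfix ha0 ha M
    (fun _ => Submodule.span K (Set.range g)) lam' ?_ ?_
  · simpa [finrank_span_eq_card hg] using hM
  · intro u x hx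
    have hsum : ∀ y, ∑ n ∈ Finset.range M, lam' n * (scaledAut τ (a u) ^ n) y =
        ∑ n : Fin M, lam n * (scaledAut τ (a u) ^ (n : ℕ)) y := fun y => by
      rw [Finset.sum_range]
      simp [hlam']
    rw [hsum]
    induction hx using Submodule.span_induction with
    | mem x hx =>
      obtain ⟨p, rfl⟩ := hx
      have := congrFun hlam (u, p)
      simp only [Finset.sum_apply, Pi.smul_apply, smul_eq_mul, Pi.zero_apply, mooreRow] at this
      refine (mul_eq_zero.mp ?_).resolve_left (hd u)
      rw [Finset.mul_sum, ← this]
      refine Finset.sum_congr rfl fun n _ => ?_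
      rw [scaledAut_pow_apply]
      ring
    | zero => simp
    | add x y _ _ hx hy => simp only [map_add, mul_add, Finset.sum_add_distrib, hx, hy, add_zero]
    | smul κ x _ hx => simp only [map_smul, mul_smul_comm, ← Finset.smul_sum, hx, smul_zero]

end Moore

/-! ### Ranks of orthogonal families of rows -/

section RankCount

variable {L : Type*} [Field L]

lemma finrank_span_add_finrank_span_le {J ι κ : Type*} [Fintype J] [Fintype ι]
    (A : ι → J → L) (B : κ → J → L) (h : ∀ i j, A i ⬝ᵥ B j = 0) :
    Module.finrank L (Submodule.span L (Set.range A)) +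
      Module.finrank L (Submodule.span L (Set.range B)) ≤ Fintype.card J := by
  have h1 : Module.finrank L (Submodule.span L (Set.range A)) = (Matrix.of A).rank :=
    (Matrix.rank_eq_finrank_span_row (Matrix.of A)).symm
  have h2 : Submodule.span L (Set.range B) ≤ LinearMap.ker (Matrix.of A).mulVecLin := by
    rw [Submodule.span_le]
    rintro _ ⟨j, rfl⟩
    exact funext fun i => h i j
  have h3 := (Matrix.of A).mulVecLin.finrank_range_add_finrank_ker
  rw [Module.finrank_fintype_fun_eq_card] at h3
  rw [h1, Matrix.rank]
  have := Submodule.finrank_mono h2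
  omega

variable {V : Type*} [AddCommGroup V] [Module L V] [FiniteDimensional L V]

lemma min_le_finrank_span_range {y : ℕ → V} {N : ℕ}
    (hy : ∀ M ≤ N, LinearIndependent L fun n : Fin M => y n) (M : ℕ) :
    min N M ≤ Module.finrank L (Submodule.span L (y '' Set.Iio M)) := by
  have h := finrank_span_eq_card (hy (min N M) (min_le_left _ _))
  rw [Fintype.card_fin] at h
  rw [← h]
  refine Submodule.finrank_mono (Submodule.span_mono ?_)
  rintro _ ⟨n, rfl⟩
  exact ⟨n, lt_of_lt_of_le n.2 (min_le_right _ _), rfl⟩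

/-- Leaving out vectors from `y 0, …, y (M - 1)` lowers the rank by at most their number. -/
lemma min_le_finrank_span_image_add {y : ℕ → V} {N : ℕ}
    (hy : ∀ M ≤ N, LinearIndependent L fun n : Fin M => y n) (M : ℕ) {T : Finset ℕ}
    (hT : T ⊆ Finset.range M) :
    min N M ≤ Module.finrank L (Submodule.span L (y '' T)) + (M - T.card) := by
  classical
  refine (min_le_finrank_span_range hy M).trans ?_
  have e : y '' Set.Iio M = y '' T ∪ ((Finset.range M \ T).image y : Finset V) := by
    rw [Finset.coe_image, ← Set.image_union, Finset.coe_sdiff, Finset.coe_range,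
      Set.union_sdiff_cancel]
    intro x hx
    simpa using hT hx
  rw [e, Submodule.span_union]
  refine (Submodule.finrank_add_le_finrank_add_finrank _ _).trans (Nat.add_le_add_left ?_ _)
  refine (finrank_span_finset_le_card _).trans (Finset.card_image_le.trans ?_)
  rw [Finset.card_sdiff_of_subset hT, Finset.card_range]

/-- The rank count behind the Roos bound. If `D` rows `A i` and `r + 1` rows `y (n j)` taken from
`y 0, …, y (D + r - 1)` are orthogonal, and initial segments of both families have the largest
possible rank, then there are more than `D + r` columns: with `N ≤ D + r` columns the ranks of the
two families would add up to more than `N`. -/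
theorem lt_card_of_orthogonal {J : Type*} [Fintype J] [Nonempty J] {A y : ℕ → J → L} {D r : ℕ}
    (hA : ∀ M ≤ Fintype.card J, LinearIndependent L fun n : Fin M => A n)
    (hy : ∀ M ≤ Fintype.card J, LinearIndependent L fun n : Fin M => y n)
    (hy0 : ∀ n, y n ≠ 0) {n : Fin (r + 1) → ℕ} (hn : Function.Injective n)
    (hnD : ∀ j, n j < D + r) (hAy : ∀ i < D, ∀ j, A i ⬝ᵥ y (n j) = 0) :
    D + r < Fintype.card J := by
  classical
  by_contra! hJ
  set T : Finset ℕ := Finset.univ.image n with hTdef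
  have hT : T.card = r + 1 := by
    rw [hTdef, Finset.card_image_of_injective _ hn, Finset.card_univ, Fintype.card_fin]
  have hTD : T ⊆ Finset.range (D + r) := by
    intro x hx
    obtain ⟨j, -, rfl⟩ := Finset.mem_image.mp hx
    exact Finset.mem_range.mpr (hnD j)
  have hTy : y '' T = Set.range (y ∘ n) := by
    rw [hTdef, Finset.coe_image, Finset.coe_univ, Set.image_univ, Set.range_comp]
  have hAD : A '' Set.Iio D = Set.range fun i : Fin D => A i := by
    ext v
    simp [Fin.exists_iff]
  have h1 := min_le_finrank_span_range hA D
  have h2 := min_le_finrank_span_image_add hy (D + r) hTD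
  have h3 := finrank_span_add_finrank_span_le (fun i : Fin D => A i) (y ∘ n)
    fun i j => hAy i i.2 j
  have h4 : 0 < Module.finrank L (Submodule.span L (Set.range (y ∘ n))) := by
    rw [Module.finrank_pos_iff_exists_ne_zero]
    exact ⟨⟨y (n 0), Submodule.subset_span ⟨0, rfl⟩⟩, fun h => hy0 _ (congrArg Subtype.val h)⟩
  have h5 : T.card ≤ D + r := by simpa using Finset.card_le_card hTD
  rw [hAD] at h1
  rw [hTy] at h2
  have h6 : 0 < Fintype.card J := Fintype.card_pos
  omega

end RankCount

/-! ### Codewords of minimum weight -/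

section MinDist

lemma exists_minDist_eq {F V : Type*} [Field F] [AddCommGroup V] [Module F V] (d : V → V → ℕ)
    {C : Submodule F V} (hC : C ≠ ⊥) :
    ∃ u ∈ C, ∃ v ∈ C, u ≠ v ∧ minDist d (C : Set V) = d u v := by
  obtain ⟨x, hx, hx0⟩ := C.ne_bot_iff.mp hC
  exact Nat.sInf_mem (s := {w | ∃ u ∈ C, ∃ v ∈ C, u ≠ v ∧ w = d u v})
    ⟨_, x, hx, 0, C.zero_mem, hx0, rfl⟩

lemma exists_minHammingDist_eq {F : Type*} [Field F] [DecidableEq F] {ℓ : ℕ}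
    {C : Submodule F (Fin ℓ → F)} (hC : C ≠ ⊥) :
    ∃ c ∈ C, c ≠ 0 ∧ minHammingDist C = hammingNorm c := by
  obtain ⟨u, hu, v, hv, huv, h⟩ := exists_minDist_eq (fun u v => hammingDist u v) hC
  refine ⟨-u + v, C.add_mem (C.neg_mem hu) hv, by rwa [ne_eq, neg_add_eq_zero], ?_⟩
  rw [← hammingDist_eq_hammingNorm, minHammingDist]
  convert h

lemma exists_minRankDist_eq (E : Type*) {F : Type*} [Field E] [Field F] [Algebra E F] {N : ℕ}
    {C : Submodule F (Fin N → F)} (hC : C ≠ ⊥) :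
    ∃ v ∈ C, v ≠ 0 ∧ minRankDist E C = rankWeight E v := by
  obtain ⟨u, hu, v, hv, huv, h⟩ := exists_minDist_eq (fun u v => rankWeight E (u - v)) hC
  exact ⟨u - v, C.sub_mem hu hv, sub_ne_zero.mpr huv, h⟩

end MinDist

/-! ### Zeros of cyclic codes -/

section CyclicZeros

/-- The codewords of a cyclic code vanish on its defining set. -/
lemma sum_mul_pow_eq_zero {F L : Type*} [Field F] [Field L] [Algebra F L] {ℓ : ℕ}
    {C : Submodule F (Fin ℓ → F)} {f : F[X]} (hf : IsGeneratorPoly C f) {c : Fin ℓ → F}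
    (hc : c ∈ C) {α : L} (hα : α ∈ hammingDefiningSet L ℓ f) :
    ∑ i, algebraMap F L (c i) * α ^ (i : ℕ) = 0 := by
  obtain ⟨-, -, h⟩ := hf
  have h1 : cyclicPoly c ∈ Ideal.span {Ideal.Quotient.mk (Ideal.span {(X ^ ℓ - 1 : F[X])}) f} := by
    rw [← SetLike.mem_coe, ← h]
    exact ⟨c, hc, rfl⟩
  obtain ⟨q', hq⟩ := Ideal.mem_span_singleton'.mp h1
  obtain ⟨q, rfl⟩ := Ideal.Quotient.mk_surjective q'
  rw [← map_mul, cyclicPoly, Ideal.Quotient.eq] at hq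
  obtain ⟨p, hp⟩ := Ideal.mem_span_singleton'.mp hq
  have h2 := congrArg (aeval α) hp
  simp only [map_mul, map_sub, map_pow, map_sum, aeval_X, map_one, hα.1, hα.2, sub_self,
    mul_zero, zero_sub, aeval_monomial] at h2
  exact neg_eq_zero.mp h2.symm

end CyclicZeros

/-! ### Skew polynomials as operators -/

section SkewOperator

variable {R S : Type*} [CommRing R] [CommRing S] [Algebra R S]

/-- The additive operator `x ↦ c σⁿ(x)` on `S`, as an additive function of `c`. -/
def monomialOperator (σ : S →+* S) (n : ℕ) : R →+ Module.End ℤ S :=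
  AddMonoidHom.mk' (fun c => LinearMap.mulLeft ℤ (algebraMap R S c) *
    ((σ ^ n : S →+* S) : S →+ S).toIntLinearMap) fun c d => by
      ext x
      simp [add_mul]

lemma monomialOperator_apply (σ : S →+* S) (n : ℕ) (c : R) (x : S) :
    monomialOperator σ n c x = algebraMap R S c * (σ^[n]) x := by
  rw [← RingHom.coe_pow]
  rfl

lemma smul_iterateAction (θ : R →+* R) (n : ℕ) (x : R) :
    let := iterateAction θ
    (Multiplicative.ofAdd n) • x = (θ^[n]) x := by
  let := iterateAction θ
  change (θ ^ n) x = _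
  rw [RingHom.coe_pow]

lemma SkewPoly.monomial_zero_right (θ : R →+* R) (n : ℕ) : SkewPoly.monomial θ n 0 = 0 :=
  SkewPolynomial.monomial_zero_right n

lemma SkewPoly.monomial_add (θ : R →+* R) (n : ℕ) (a b : R) :
    SkewPoly.monomial θ n (a + b) = SkewPoly.monomial θ n a + SkewPoly.monomial θ n b :=
  SkewPolynomial.monomial_add n a b

lemma SkewPoly.monomial_mul_monomial (θ : R →+* R) (n k : ℕ) (c d : R) :
    SkewPoly.monomial θ n c * SkewPoly.monomial θ k d =
      SkewPoly.monomial θ (n + k) (c * (θ^[n]) d) := by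
  let := iterateAction θ
  rw [← smul_iterateAction]
  exact SkewMonoidAlgebra.single_mul_single

lemma SkewPoly.add_induction {θ : R →+* R} {motive : SkewPoly R θ → Prop} (f : SkewPoly R θ)
    (zero : motive 0) (monomial : ∀ n c, motive (SkewPoly.monomial θ n c))
    (add : ∀ f g, motive f → motive g → motive (f + g)) : motive f :=
  SkewPolynomial.induction (R := R) (motive := motive) f zero
    fun n c _ _ _ hq => add _ _ (monomial n c) hq

/-- The action of `R[z; θ]` on `S` in which `z` acts as `σ`, as an additive map. -/
def SkewPoly.operatorAux (θ : R →+* R) (σ : S →+* S) : SkewPoly R θ →+ Module.End ℤ S where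
  toFun f := SkewPolynomial.sum (R := R) f fun n c => monomialOperator σ n c
  map_zero' := SkewMonoidAlgebra.sum_zero_index
  map_add' _ _ := SkewMonoidAlgebra.sum_add_index'
    (fun n => (monomialOperator σ (Multiplicative.toAdd n)).map_zero)
    fun n => (monomialOperator σ (Multiplicative.toAdd n)).map_add

lemma SkewPoly.operatorAux_monomial (θ : R →+* R) (σ : S →+* S) (n : ℕ) (c : R) :
    SkewPoly.operatorAux θ σ (SkewPoly.monomial θ n c) = monomialOperator σ n c :=
  SkewPolynomial.sum_monomial_index (h := fun n c => monomialOperator σ n c)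
    (monomialOperator σ n).map_zero

/-- The ring homomorphism from `R[z; θ]` to the additive endomorphisms of `S` under which `z` acts
as `σ` and the coefficients act by multiplication. -/
def SkewPoly.operator (θ : R →+* R) (σ : S →+* S)
    (h : ∀ x, σ (algebraMap R S x) = algebraMap R S (θ x)) : SkewPoly R θ →+* Module.End ℤ S :=
  { SkewPoly.operatorAux θ σ with
    map_one' := by
      change SkewPoly.operatorAux θ σ (SkewPoly.monomial θ 0 1) = 1
      rw [SkewPoly.operatorAux_monomial]
      ext x
      simp [monomialOperator_apply]
    map_mul' := fun f g => by
      change SkewPoly.operatorAux θ σ (f * g) =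
        SkewPoly.operatorAux θ σ f * SkewPoly.operatorAux θ σ g
      induction f using SkewPoly.add_induction with
      | zero => simp
      | add f f' hf hf' => rw [add_mul, map_add, map_add, add_mul, hf, hf']
      | monomial n c =>
        induction g using SkewPoly.add_induction with
        | zero => simp
        | add g g' hg hg' => rw [mul_add, map_add, map_add, mul_add, hg, hg']
        | monomial k d =>
          have hn : ∀ n : ℕ, (σ^[n]) (algebraMap R S d) = algebraMap R S ((θ^[n]) d) := fun n => by
            induction n with
            | zero => rfl
            | succ n ih =>
              rw [Function.iterate_succ_apply', Function.iterate_succ_apply', ih, h]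
          ext x
          rw [SkewPoly.monomial_mul_monomial, Module.End.mul_apply]
          simp only [SkewPoly.operatorAux_monomial, monomialOperator_apply]
          rw [iterate_map_mul, hn, map_mul, Function.iterate_add_apply, mul_assoc] }

lemma SkewPoly.operator_monomial (θ : R →+* R) (σ : S →+* S)
    (h : ∀ x, σ (algebraMap R S x) = algebraMap R S (θ x)) (n : ℕ) (c : R) (x : S) :
    SkewPoly.operator θ σ h (SkewPoly.monomial θ n c) x = algebraMap R S c * (σ^[n]) x := by
  rw [← monomialOperator_apply]
  exact DFunLike.congr_fun (SkewPoly.operatorAux_monomial θ σ n c) x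

lemma SkewPoly.operator_baseChange (θ : R →+* R) (σ : S →+* S)
    (h : ∀ x, σ (algebraMap R S x) = algebraMap R S (θ x)) (f : SkewPoly R θ) :
    SkewPoly.operator σ σ (fun _ => rfl) (f.baseChange σ) = SkewPoly.operator θ σ h f := by
  have hadd : ∀ f g : SkewPoly R θ,
      (f + g).baseChange σ = f.baseChange σ + g.baseChange σ := fun f g =>
    SkewMonoidAlgebra.sum_add_index' (S := SkewPolynomial S)
      (fun n => (congrArg (SkewPoly.monomial σ (Multiplicative.toAdd n)) (map_zero _)).trans
        (SkewPoly.monomial_zero_right _ _))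
      fun n a b => (congrArg (SkewPoly.monomial σ (Multiplicative.toAdd n)) (map_add _ a b)).trans
        (SkewPoly.monomial_add _ _ _ _)
  induction f using SkewPoly.add_induction with
  | zero =>
    have : (0 : SkewPoly R θ).baseChange σ = 0 := by simpa using hadd 0 0
    rw [this, map_zero, map_zero]
  | add f g hf hg => rw [hadd, map_add, map_add, hf, hg]
  | monomial n c =>
    have : (SkewPoly.monomial θ n c).baseChange σ =
        SkewPoly.monomial σ n (algebraMap R S c) := by
      refine SkewPolynomial.sum_monomial_index
        (h := fun n c => SkewPoly.monomial σ n (algebraMap R S c)) ?_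
      rw [map_zero, SkewPoly.monomial_zero_right]
    ext x
    rw [this, SkewPoly.operator_monomial, SkewPoly.operator_monomial]
    rfl

end SkewOperator

/-! ### Zeros of skew-cyclic codes -/

section SkewZeros

variable {F L : Type*} [Field F] [Field L] [Algebra F L]

/-- The operator of `z - σ(γ) γ⁻¹` kills `γ`, so right evaluation at `σ(γ) γ⁻¹` is, up to the
factor `γ`, the value of the operator at `γ`. -/
lemma SkewPoly.operator_apply_of_mem_rankDefiningSet {θ : F →+* F} {σ : L →+* L}
    (h : ∀ x, σ (algebraMap F L x) = algebraMap F L (θ x)) {f : SkewPoly F θ} {γ : Lˣ}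
    (hγ : γ ∈ rankDefiningSet σ f) : SkewPoly.operator θ σ h f (γ : L) = 0 := by
  obtain ⟨q, hq⟩ := hγ
  rw [← SkewPoly.operator_baseChange, hq, map_add, map_mul, map_sub, LinearMap.add_apply,
    Module.End.mul_apply, LinearMap.sub_apply]
  simp [SkewPoly.operator_monomial]

/-- The codewords of a skew-cyclic code, seen as operators on `L`, vanish on its defining set. -/
lemma sum_mul_iterate_eq_zero {θ : F →+* F} {σ : L →+* L}
    (h : ∀ x, σ (algebraMap F L x) = algebraMap F L (θ x)) {N : ℕ} (hN : ∀ x, (σ^[N]) x = x)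
    {C : Submodule F (Fin N → F)} {f : SkewPoly F θ} (hf : IsSkewGenerator θ C f)
    {v : Fin N → F} (hv : v ∈ C) {γ : Lˣ} (hγ : γ ∈ rankDefiningSet σ f) :
    ∑ j, algebraMap F L (v j) * (σ^[(j : ℕ)]) (γ : L) = 0 := by
  have h1 : skewCyclicPoly θ v ∈ Ideal.span {(skewCyclicCon θ N).mk' f} := by
    rw [← SetLike.mem_coe, ← hf]
    exact ⟨v, hv, rfl⟩
  obtain ⟨q', hq⟩ := Ideal.mem_span_singleton'.mp h1
  obtain ⟨q, rfl⟩ := (skewCyclicCon θ N).mk'_surjective q'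
  rw [← map_mul, skewCyclicPoly] at hq
  have h2 : q * f - ∑ j : Fin N, SkewPoly.monomial θ (j : ℕ) (v j) ∈
      TwoSidedIdeal.span {SkewPoly.monomial θ N 1 - 1} := by
    rw [← TwoSidedIdeal.rel_iff]
    exact (RingCon.eq _).mp hq
  have h3 : TwoSidedIdeal.span {SkewPoly.monomial θ N 1 - 1} ≤
      TwoSidedIdeal.ker (SkewPoly.operator θ σ h) := by
    rw [TwoSidedIdeal.span_le]
    rintro _ rfl
    rw [SetLike.mem_coe, TwoSidedIdeal.mem_ker]
    ext x
    rw [map_sub, map_one, LinearMap.sub_apply, SkewPoly.operator_monomial, hN]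
    simp
  have h4 := (TwoSidedIdeal.mem_ker _).mp (h3 h2)
  have h5 := DFunLike.congr_fun h4 (γ : L)
  rw [map_sub, map_mul, LinearMap.sub_apply, Module.End.mul_apply,
    SkewPoly.operator_apply_of_mem_rankDefiningSet h hγ, map_zero, zero_sub, map_sum,
    LinearMap.sum_apply] at h5
  simp only [SkewPoly.operator_monomial] at h5
  exact neg_eq_zero.mp h5

end SkewZeros

/-! ### Galois generators, linear disjointness and rank factorizations -/

section Fields

lemma mem_range_algebraMap_of_zpowers_eq_top {K L : Type*} [Field K] [Field L] [Algebra K L]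
    [FiniteDimensional K L] [IsGalois K L] {τ : L ≃ₐ[K] L} (hτ : Subgroup.zpowers τ = ⊤) (x : L)
    (hx : τ x = x) : x ∈ Set.range (algebraMap K L) := by
  rw [IsGalois.mem_range_algebraMap_iff_fixed]
  intro g
  have h1 : Subgroup.zpowers τ ≤ MulAction.stabilizer (L ≃ₐ[K] L) x :=
    Subgroup.zpowers_le.mpr hx
  rw [hτ] at h1
  exact h1 (Subgroup.mem_top g)

lemma zpowers_zpow_eq_top {G : Type*} [Group G] {x : G} (hx : Subgroup.zpowers x = ⊤) {m : ℕ}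
    (hxm : x ^ m = 1) {s : ℤ} (hs : IsCoprime (m : ℤ) s) : Subgroup.zpowers (x ^ s) = ⊤ := by
  obtain ⟨p, q, hpq⟩ := hs
  rw [eq_top_iff, ← hx, Subgroup.zpowers_le]
  refine ⟨q, ?_⟩
  have : x ^ (p * m + q * s) = x := by rw [hpq, zpow_one]
  rwa [zpow_add, mul_comm p, zpow_mul, zpow_natCast, hxm, one_zpow, one_mul, mul_comm q,
    zpow_mul] at this

lemma linearDisjoint_of_finrank_eq {E L : Type*} [Field E] [Field L] [Algebra E L]
    {K F : IntermediateField E L} [FiniteDimensional E K] [FiniteDimensional E F]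
    (hL : K ⊔ F = ⊤) (h : Module.finrank K L = Module.finrank E F) : K.LinearDisjoint F := by
  refine IntermediateField.LinearDisjoint.of_finrank_sup ?_
  rw [hL, IntermediateField.finrank_top', ← h, Module.finrank_mul_finrank]

/-- A rank factorization of a vector over an extension field, with as many terms as its rank
weight. The last clause says that the `E`-rows of the factorization are independent over every
extension `K` of `E`. -/
lemma exists_rank_factorization (E K : Type*) {F : Type*} [Field E] [Field F] [Algebra E F]
    [Field K] [Algebra E K] {N : ℕ} (v : Fin N → F) :
    ∃ (g : Fin (rankWeight E v) → F) (e : Fin (rankWeight E v) → Fin N → E),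
      LinearIndependent E g ∧ (∀ j, v j = ∑ p, e p j • g p) ∧
      ∀ κ : Fin (rankWeight E v) → K, (∀ j, ∑ p, e p j • κ p = 0) → κ = 0 := by
  set S := Submodule.span E (Set.range v) with hS
  have : FiniteDimensional E S := FiniteDimensional.span_of_finite E (Set.finite_range v)
  let bs : Module.Basis (Fin (rankWeight E v)) E S := Module.finBasis E S
  let w : Fin N → S := fun j => ⟨v j, Submodule.subset_span ⟨j, rfl⟩⟩
  refine ⟨fun p => bs p, fun p j => bs.repr (w j) p, ?_, fun j => ?_, fun κ hκ => ?_⟩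
  · exact bs.linearIndependent.map' S.subtype S.ker_subtype
  · have := congrArg S.subtype (bs.sum_repr (w j))
    rw [map_sum] at this
    exact this.symm
  · have h0 : bs.constr E κ = 0 := by
      have hw : Submodule.span E (Set.range w) = ⊤ := by
        have : Set.range w = (Subtype.val ⁻¹' Set.range v : Set S) := by
          ext ⟨x, hx⟩
          simp [w, Subtype.ext_iff]
        rw [this]
        exact Submodule.span_span_coe_preimage
      refine LinearMap.ext_on_range hw fun j => ?_
      rw [bs.constr_apply_fintype E, LinearMap.zero_apply, ← hκ j]
      rfl
    funext p
    rw [← bs.constr_basis E κ p, h0]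
    rfl

end Fields

/-! ### The product bound for a pair of vectors -/

section Core

variable {K L : Type*} [Field K] [Field L] [Algebra K L]

/-- The Roos product bound in terms of the defining sums of the two codewords: `c` is a vector
over `K`, and `∑ p, g p σⁿ(w p)` is the value of a codeword of rank weight `|P|`. -/
theorem lt_card_mul_card_of_forall_sum_eq_zero [DecidableEq K] [FiniteDimensional K L]
    [IsGalois K L] {σ : L ≃ₐ[K] L} {ℓ m : ℕ} (hℓ : 0 < ℓ) (hσ : Subgroup.zpowers σ = ⊤)
    (hσm : σ ^ m = 1) (hcop : Nat.Coprime ℓ m) {a : K} (ha : IsPrimitiveRoot a ℓ)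
    {c : Fin ℓ → K} (hc : c ≠ 0)
    {P : Type*} [Fintype P] [Nonempty P] {g w : P → L} (hg : LinearIndependent K g)
    (hw : LinearIndependent K w) {b s : ℤ} {D r : ℕ} {k : Fin (r + 1) → ℤ}
    (hs : IsCoprime ((ℓ : ℤ) * m) s) (hk : StrictMono k) (hkD : k (Fin.last r) - k 0 < D + r)
    (h : ∀ i : ℕ, i < D → ∀ j, ∑ u, c u * (a ^ (b + s * i + k j)) ^ (u : ℕ) = 0 ∨
      ∑ p, g p * (σ ^ (s * i + k j)) (w p) = 0) :
    D + r < Fintype.card {u // c u ≠ 0} * Fintype.card P := by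
  have ha0 : a ≠ 0 := ha.ne_zero hℓ.ne'
  have hsℓ : IsCoprime (ℓ : ℤ) s := hs.of_mul_left_left
  have hsm : IsCoprime (m : ℤ) s := hs.of_mul_left_right
  have hℓm : IsCoprime (ℓ : ℤ) m := Nat.isCoprime_iff_coprime.mpr hcop
  have hU : Nonempty {u // c u ≠ 0} := by
    obtain ⟨u, hu⟩ := Function.ne_iff.mp hc
    exact ⟨u, hu⟩
  have hfix1 := mem_range_algebraMap_of_zpowers_eq_top (zpowers_zpow_eq_top hσ hσm hsm)
  have hfix2 := mem_range_algebraMap_of_zpowers_eq_top (τ := σ⁻¹) (by rw [Subgroup.zpowers_inv, hσ])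
  have hinj : ∀ z : ℤ, IsCoprime (ℓ : ℤ) z → Function.Injective
      fun u : {u : Fin ℓ // c u ≠ 0} => (a ^ z) ^ ((u : Fin ℓ) : ℕ) := by
    intro z hz u u' huu
    have := (ha.zpow_of_gcd_eq_one z (by
      rw [Int.gcd_comm]; exact Int.isCoprime_iff_gcd_eq_one.mp hz)).pow_inj u.1.2 u'.1.2 huu
    exact Subtype.ext (Fin.ext this)
  -- the rows coming from the indices `s i`, with `σ ^ s` as the automorphism
  let A : ℕ → {u : Fin ℓ // c u ≠ 0} × P → L :=
    mooreRow (σ ^ s) (fun u => (a ^ s) ^ ((u : Fin ℓ) : ℕ)) (fun _ => 1) w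
  -- the rows coming from the indices `k j`, moved to the other side by `σ ^ (-k j)`
  let d : {u : Fin ℓ // c u ≠ 0} → L := fun u =>
    algebraMap K L (c u * (a ^ (b + k 0)) ^ (u : ℕ))
  have hd : ∀ u, d u ≠ 0 := fun u => by
    rw [ne_eq, FaithfulSMul.algebraMap_eq_zero_iff]
    exact mul_ne_zero u.2 (pow_ne_zero _ (zpow_ne_zero _ ha0))
  let B : ℕ → {u : Fin ℓ // c u ≠ 0} × P → L :=
    mooreRow σ⁻¹ (fun u => a ^ ((u : Fin ℓ) : ℕ)) d fun p => (σ ^ (-k 0)) (g p)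
  have hg' : LinearIndependent K fun p => (σ ^ (-k 0)) (g p) :=
    hg.map' (σ ^ (-k 0)).toLinearMap (LinearMap.ker_eq_bot.mpr (σ ^ (-k 0)).injective)
  have hA : ∀ M ≤ Fintype.card ({u : Fin ℓ // c u ≠ 0} × P),
      LinearIndependent L fun n : Fin M => A n := fun M hM => by
    refine linearIndependent_moore (m := m) ?_ hfix1 (fun u => pow_ne_zero _ (zpow_ne_zero _ ha0))
      ?_ (fun _ => one_ne_zero) hw (by rwa [Fintype.card_prod] at hM)
    · rw [← zpow_natCast, zpow_comm, zpow_natCast, hσm, one_zpow]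
    · have e : ∀ n : ℕ, ((a ^ s) ^ n) ^ m = (a ^ (s * m)) ^ n := fun n => by
        rw [zpow_mul, zpow_natCast, pow_right_comm]
      exact fun u u' huu => hinj (s * m) (hsℓ.mul_right hℓm) (by simpa only [e] using huu)
  have hB : ∀ M ≤ Fintype.card ({u : Fin ℓ // c u ≠ 0} × P),
      LinearIndependent L fun n : Fin M => B n := fun M hM => by
    refine linearIndependent_moore (m := m) (by rw [inv_pow, hσm, inv_one]) hfix2
      (fun u => pow_ne_zero _ ha0) ?_ hd hg' (by rwa [Fintype.card_prod] at hM)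
    have e : ∀ n : ℕ, (a ^ n) ^ m = (a ^ (m : ℤ)) ^ n := fun n => by
      rw [zpow_natCast, pow_right_comm]
    exact fun u u' huu => hinj m hℓm (by simpa only [e] using huu)
  have hk0 : ∀ j, 0 ≤ k j - k 0 := fun j => sub_nonneg.mpr (hk.monotone (Fin.zero_le j))
  rw [← Fintype.card_prod]
  refine lt_card_of_orthogonal (A := A) (y := B) hA hB ?_ (n := fun j => (k j - k 0).toNat)
    ?_ ?_ ?_
  · intro n hn
    obtain ⟨u⟩ := hU
    obtain ⟨p⟩ := ‹Nonempty P›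
    have := congrFun hn (u, p)
    simp [B, mooreRow, hd, ha0, hg.ne_zero] at this
  · intro j j' hjj
    have h1 := hk0 j
    have h2 := hk0 j'
    refine hk.injective ?_
    simp only at hjj
    omega
  · intro j
    have h1 := hk0 j
    have h2 := hk.monotone (Fin.le_last j)
    omega
  · intro i hi j
    have key : ∀ x : {u : Fin ℓ // c u ≠ 0} × P, A i x * B (k j - k 0).toNat x =
        algebraMap K L (c x.1 * (a ^ (b + s * i + k j)) ^ ((x.1 : Fin ℓ) : ℕ)) *
          (σ ^ (-k j)) (g x.2 * (σ ^ (s * i + k j)) (w x.2)) := by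
      rintro ⟨⟨u, hu⟩, p⟩
      have e1 : ((σ⁻¹) ^ (k j - k 0).toNat) ((σ ^ (-k 0)) (g p)) = (σ ^ (-k j)) (g p) := by
        rw [← AlgEquiv.mul_apply, ← zpow_natCast, Int.toNat_of_nonneg (hk0 j), inv_zpow',
          ← zpow_add]
        congr 2
        ring
      have e2 : ((σ ^ s) ^ i) (w p) = (σ ^ (-k j)) ((σ ^ (s * i + k j)) (w p)) := by
        rw [← AlgEquiv.mul_apply, ← zpow_natCast, ← zpow_mul, ← zpow_add]
        congr 2
        ring
      have e3 : ((a ^ s) ^ (u : ℕ)) ^ i * (a ^ (b + k 0)) ^ (u : ℕ) *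
          (a ^ (u : ℕ)) ^ (k j - k 0).toNat = (a ^ (b + s * i + k j)) ^ (u : ℕ) := by
        simp only [← zpow_natCast, ← zpow_mul, Int.toNat_of_nonneg (hk0 j)]
        rw [← zpow_add₀ ha0, ← zpow_add₀ ha0]
        congr 1
        ring
      simp only [A, B, mooreRow, d, e1, e2, ← e3, Algebra.smul_def, map_mul]
      ring
    have hsum : A i ⬝ᵥ B (k j - k 0).toNat =
        algebraMap K L (∑ u, c u * (a ^ (b + s * i + k j)) ^ (u : ℕ)) *
          (σ ^ (-k j)) (∑ p, g p * (σ ^ (s * i + k j)) (w p)) := by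
      rw [dotProduct, Finset.sum_congr rfl fun x _ => key x, map_sum, map_sum,
        Fintype.sum_prod_type, Fintype.sum_mul_sum,
        ← Finset.sum_filter_of_ne (p := fun u => c u ≠ 0),
        Finset.sum_subtype (p := fun u => c u ≠ 0) _ (by simp)]
      intro u _ hu h0
      simp [h0] at hu
    rw [hsum]
    rcases h i hi j with h0 | h0 <;> simp [h0]

end Core

/-! ### Conjugates of a normal element -/

section Assembly

lemma iterate_coe_algEquiv {K L : Type*} [Field K] [Field L] [Algebra K L] (σ : L ≃ₐ[K] L) (n : ℕ)
    (x : L) : ((σ : L →+* L)^[n]) x = (σ ^ n) x := by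
  induction n with
  | zero => rfl
  | succ n ih => rw [Function.iterate_succ_apply', ih, pow_succ', AlgEquiv.mul_apply]; rfl

/-- An automorphism of `L / K` whose restriction to an intermediate field has order `[L : K]`
has itself this order, the largest possible one. -/
lemma orderOf_eq_finrank_of_restrict {E L : Type*} [Field E] [Field L] [Algebra E L]
    {K F : IntermediateField E L} [FiniteDimensional K L] [IsGalois K L] {σ : L ≃ₐ[K] L}
    {θ : F ≃ₐ[E] F} (hθ : ∀ x : F, σ (x : L) = (θ x : L))
    (hord : orderOf θ = Module.finrank K L) : orderOf σ = Module.finrank K L := by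
  refine Nat.dvd_antisymm ?_ ?_
  · rw [← IsGalois.card_aut_eq_finrank]
    exact orderOf_dvd_natCard σ
  · rw [← hord]
    refine orderOf_dvd_of_pow_eq_one (AlgEquiv.ext fun x => Subtype.ext ?_)
    have h : ∀ n : ℕ, (σ ^ n) (x : L) = ((θ ^ n) x : L) := fun n => by
      induction n with
      | zero => rfl
      | succ n ih => rw [pow_succ', AlgEquiv.mul_apply, ih, hθ, pow_succ', AlgEquiv.mul_apply]
    rw [← h, pow_orderOf_eq_one]
    rfl

/-- The conjugates `σ ^ j (β)` of a normal element, combined by `E`-rows that are independent over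
`K`, stay `K`-linearly independent. -/
lemma linearIndependent_sum_smul_conjugates {E K L : Type*} [Field E] [Field K] [Field L]
    [Algebra E K] [Algebra K L] [Algebra E L] [IsScalarTower E K L] {σ : L ≃ₐ[K] L} {m t : ℕ}
    (hσ : orderOf σ = m) {β : L} (hβ : IsNormalElement K β) {e : Fin t → Fin m → E}
    (he : ∀ κ : Fin t → K, (∀ j, ∑ p, e p j • κ p = 0) → κ = 0) :
    LinearIndependent K fun p => ∑ j, e p j • (σ ^ (j : ℕ)) β := by
  have hconj : LinearIndependent K fun j : Fin m => (σ ^ (j : ℕ)) β :=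
    hβ.1.comp (fun j : Fin m => σ ^ (j : ℕ)) fun i j hij =>
      Fin.ext (pow_injOn_Iio_orderOf (by simp [hσ]) (by simp [hσ]) hij)
  rw [Fintype.linearIndependent_iff]
  intro κ hκ
  refine congrFun (he κ fun j => ?_)
  refine Fintype.linearIndependent_iff.mp hconj (fun j => ∑ p, e p j • κ p) ?_ j
  rw [← hκ]
  simp only [Finset.sum_smul, Finset.smul_sum]
  rw [Finset.sum_comm]
  refine Finset.sum_congr rfl fun p _ => Finset.sum_congr rfl fun j _ => ?_
  rw [smul_assoc, smul_comm]

end Assembly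

end RoosProduct

end

open RoosProduct in
theorem theorem6p2 {E L : Type*} [Field E] [Field L] [Algebra E L]
    -- the fields: `K ∩ F = E`, `L = F K`, `[F : E] = [L : K] = m`, `L / K` cyclic Galois
    (K F : IntermediateField E L) [FiniteDimensional E K] [FiniteDimensional E F]
    (hKF : K ⊓ F = ⊥) (hL : K ⊔ F = ⊤)
    (ℓ m : ℕ) (hℓ : 0 < ℓ) (hm : Module.finrank E F = m) (hmL : Module.finrank K L = m)
    (hgal : IsGalois K L) (hcyc : IsCyclic (L ≃ₐ[K] L))
    -- `θ` is the restriction of `σ` to `F`; it has order `m` and fixed field `E`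
    (σ : L ≃ₐ[K] L) (θ : F ≃ₐ[E] F) (hθ : ∀ x : F, σ (x : L) = (θ x : L))
    (hord : orderOf θ = m) (hfix : ∀ x : F, θ x = x → x ∈ Set.range (algebraMap E F))
    (hcop : Nat.Coprime ℓ m)
    -- the cyclic code `C₁`, with generator polynomial `f₁ ∈ E[x]`
    (C₁ : Submodule F (Fin ℓ → F)) (hC₁ : IsCyclicCode C₁) (hC₁0 : C₁ ≠ ⊥)
    (f₁ : Polynomial F) (hf₁ : IsGeneratorPoly C₁ f₁)
    (hf₁E : ∃ g : Polynomial E, g.map (algebraMap E F) = f₁)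
    -- the skew-cyclic code `C₂`, with generator `f₂ ∈ F[z; θ]`
    (C₂ : Submodule F (Fin m → F)) (hC₂ : IsSkewCyclicCode (θ : F →+* F) C₂) (hC₂0 : C₂ ≠ ⊥)
    (f₂ : SkewPoly F (θ : F →+* F)) (hf₂ : IsSkewGenerator (θ : F →+* F) C₂ f₂)
    (b s δ : ℤ) (r : ℕ) (k : Fin (r + 1) → ℤ)
    (hs : Int.gcd ((ℓ : ℤ) * (m : ℤ)) s = 1) (hk : StrictMono k)
    (hkδ : k (Fin.last r) - k 0 ≤ δ + r - 2)
    (a : K) (ha : IsPrimitiveRoot a ℓ)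
    (β : Lˣ) (hβ : IsNormalElement K (β : L))
    (hT : roosSet σ a β b s δ k ⊆
      uplus (hammingDefiningSet L ℓ f₁) (rankDefiningSet (σ : L →+* L) f₂)) :
    ⌈((δ : ℚ) + r) / (minRankDist E C₂ : ℚ)⌉ ≤ (minHammingDist C₁ : ℤ) ∧
      ⌈((δ : ℚ) + r) / (minHammingDist C₁ : ℚ)⌉ ≤ (minRankDist E C₂ : ℤ) := by
  classical
  have hEL : FiniteDimensional E L := by
    have h := IntermediateField.finiteDimensional_sup K F
    rw [hL] at h
    exact Module.Finite.equiv IntermediateField.topEquiv.toLinearEquiv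
  have hKL : FiniteDimensional K L := FiniteDimensional.right E K L
  have hσm : orderOf σ = m :=
    (orderOf_eq_finrank_of_restrict hθ (hord.trans hmL.symm)).trans hmL
  have hσ1 : σ ^ m = 1 := hσm ▸ pow_orderOf_eq_one σ
  have hσtop : Subgroup.zpowers σ = ⊤ := by
    refine Subgroup.eq_top_of_card_eq _ ?_
    rw [Nat.card_zpowers, hσm, IsGalois.card_aut_eq_finrank, hmL]
  obtain ⟨c, hcC, hc0, hdH⟩ := exists_minHammingDist_eq hC₁0
  obtain ⟨v, hvC, hv0, hdR⟩ := exists_minRankDist_eq E hC₂0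
  obtain ⟨g, e, hg, hv, he⟩ := exists_rank_factorization E K v
  rw [hdH, hdR]
  -- a `K`-linear functional turns `c` into a vector over `K` with the same zeros in `K`
  obtain ⟨u₀, hu₀⟩ := Function.ne_iff.mp hc0
  obtain ⟨ψ, hψ⟩ : ∃ ψ : Module.Dual K L, ψ (c u₀ : L) ≠ 0 := by
    by_contra! h
    exact hu₀ (Subtype.ext ((Module.forall_dual_apply_eq_zero_iff K _).mp h))
  have hgK : LinearIndependent K fun p => (g p : L) :=
    (linearDisjoint_of_finrank_eq hL (hmL.trans hm.symm)).linearIndependent_right hg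
  have hwK := linearIndependent_sum_smul_conjugates hσm hβ he
  have hP : Nonempty (Fin (rankWeight E v)) := by
    by_contra h
    rw [not_nonempty_iff] at h
    exact hv0 (funext fun j => by rw [hv j, Finset.univ_eq_empty, Finset.sum_empty]; rfl)
  have hval : ∀ n : ℤ, ∑ p, (g p : L) * (σ ^ n) (∑ j, e p j • (σ ^ (j : ℕ)) (β : L)) =
      ∑ j, (v j : L) * (σ ^ (j : ℕ)) ((σ ^ n) β) := fun n => by
    have hcomm : ∀ j : ℕ, (σ ^ n) ((σ ^ j) (β : L)) = (σ ^ j) ((σ ^ n) β) := fun j => by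
      rw [← AlgEquiv.mul_apply, ← AlgEquiv.mul_apply, ← zpow_natCast, zpow_mul_comm]
    have hsmul : ∀ (x : E) (y : L), (σ ^ n) (x • y) = x • (σ ^ n) y := fun x y => by
      rw [← algebraMap_smul K x y, map_smul, algebraMap_smul]
    have hvL : ∀ j, (v j : L) = ∑ p, e p j • (g p : L) := fun j => by
      rw [hv j]
      push_cast
      rfl
    simp only [map_sum, hsmul, hcomm, hvL, Finset.mul_sum, Finset.sum_mul]
    rw [Finset.sum_comm]
    refine Finset.sum_congr rfl fun j _ => Finset.sum_congr rfl fun p _ => ?_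
    rw [mul_smul_comm, smul_mul_assoc]
  -- `0 ≤ i ≤ δ - 2` means that `i` runs over the natural numbers below `D = δ - 1`
  have hmain := lt_card_mul_card_of_forall_sum_eq_zero (c := fun u => ψ (c u : L)) hℓ hσtop hσ1
    hcop ha (Function.ne_iff.mpr ⟨u₀, hψ⟩) hgK hwK (b := b) (D := (δ - 1).toNat)
    (Int.isCoprime_iff_gcd_eq_one.mpr hs) hk (by omega) (fun i hi j => by
      rcases hT ⟨i, by omega, by omega, j, rfl⟩ with h | h
      · left
        have h0 := sum_mul_pow_eq_zero hf₁ hcC h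
        have h1 := congrArg ψ h0
        rw [map_sum, map_zero] at h1
        rw [← h1]
        refine Finset.sum_congr rfl fun u _ => ?_
        rw [← map_pow, mul_comm (algebraMap F L (c u)), ← Algebra.smul_def, map_smul,
          smul_eq_mul, mul_comm]
        rfl
      · right
        rw [hval]
        have h0 := sum_mul_iterate_eq_zero (θ := (θ : F →+* F)) (σ := (σ : L →+* L)) (fun x => hθ x)
          (fun x => by rw [iterate_coe_algEquiv, hσ1]; rfl) hf₂ hvC h
        simp only [iterate_coe_algEquiv] at h0
        exact h0)
  rw [Fintype.card_fin] at hmain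
  have hU : Fintype.card {u // ψ (c u : L) ≠ 0} ≤ hammingNorm c := by
    rw [Fintype.card_subtype]
    refine Finset.card_le_card fun u hu => ?_
    simp only [Finset.mem_filter, Finset.mem_univ, true_and] at hu ⊢
    intro h
    simp [h] at hu
  have hN : (δ - 1).toNat + r < hammingNorm c * rankWeight E v :=
    hmain.trans_le (Nat.mul_le_mul_right _ hU)
  have hQ : (δ : ℚ) + r ≤ hammingNorm c * rankWeight E v := by
    have : δ + r ≤ ((hammingNorm c * rankWeight E v : ℕ) : ℤ) := by omega
    exact_mod_cast this
  have hH : (0 : ℚ) < hammingNorm c := by exact_mod_cast hammingNorm_pos_iff.mpr hc0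
  have hR : (0 : ℚ) < rankWeight E v := by exact_mod_cast Fin.pos_iff_nonempty.mpr hP
  rw [Int.ceil_le, Int.ceil_le, div_le_iff₀ hR, div_le_iff₀ hH]
  push_cast
  exact ⟨hQ, by rwa [mul_comm]⟩
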